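/- Let $X$ be an infinite set. A \emph{factor pair} of $X$ is an ordered pair $(\theta,\theta')$ of equivalence relations on $X$ with $\theta\cap\theta'=\Delta$ (the diagonal) and $\theta\circ\theta'=\nabla=X\times X$ (relational product). Let $\mathrm{Fact}(X)$ be the set of factor pairs of $X$, partially ordered by $(\theta,\theta')\le(\phi,\phi')$ iff $\phi\subseteq\theta$, $\theta'\subseteq\phi'$ and $\phi\circ\theta'=\theta'\circ\phi$; its least element is $0=(\nabla,\Delta)$. For a prime $p$, a \emph{$p$-atom} is an atom $(\theta,\theta')$ of $\mathrm{Fact}(X)$ such that every class of $\theta'$ has exactly $p$ elements. For $p$-atoms with the same first coordinate write $(\theta,\theta')\sim_p(\theta,\theta'')$ if there is a factor pair $(\gamma,\gamma')$ with $|X/\gamma|=p^3$ such that both $(\theta,\theta')$ and $(\theta,\theta'')$ belong to the interval $[0,(\gamma,\gamma')]$; $p$-atoms with different first coordinates are never $\sim_p$-related. Let $\approx_p$ be the transitive closure of $\sim_p$ on the set of $p$-atoms. \textbf{Theorem.} (1) If $(\theta,\theta')$ and $(\theta,\theta'')$ are 3-atoms of $\mathrm{Fact}(X)$ with the same first coordinate,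 then $(\theta,\theta')\approx_3(\theta,\theta'')$; that is, they are linked by a finite chain of 3-atoms with first coordinate $\theta$ in which any two consecutive members lie together below some factor pair $(\gamma,\gamma')$ with $|X/\gamma|=27$. (2) If $(\theta,\theta')$ and $(\theta,\theta'')$ are 2-atoms of $\mathrm{Fact}(X)$ with the same first coordinate, then $(\theta,\theta')\approx_2(\theta,\theta'')$, where now $|X/\gamma|=8$. -/

import Mathlib

/-- Two relations on `X` permute if their two relational products agree. -/
def Permute {X : Type*} (θ φ : Setoid X) : Prop :=
  Relation.Comp (fun x y => θ x y) (fun x y => φ x y) =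
    Relation.Comp (fun x y => φ x y) (fun x y => θ x y)

/-- A factor pair of `X`: an ordered pair of equivalence relations whose intersection is the
diagonal and whose relational product is the all relation. `FactorPair X` is the set of factor pairs. -/
@[ext]
structure FactorPair (X : Type*) where
  fst : Setoid X
  snd : Setoid X
  inf_eq : fst ⊓ snd = ⊥
  comp_eq : Relation.Comp (fun x y => fst x y) (fun x y => snd x y) = fun _ _ => True

namespace FactorPair

variable {X : Type*}

theorem eq_of_rel (a : FactorPair X) {x y : X} (h1 : a.fst x y) (h2 : a.snd x y) : x = y := by
  have h : (a.fst ⊓ a.snd) x y := ⟨h1, h2⟩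
  rw [a.inf_eq] at h
  exact h

/-- `(θ, θ') ≤ (φ, φ')` iff `φ ⊆ θ`, `θ' ⊆ φ'`, and `φ` and `θ'` permute. -/
instance : LE (FactorPair X) where
  le a b := b.fst ≤ a.fst ∧ a.snd ≤ b.snd ∧ Permute b.fst a.snd

instance : PartialOrder (FactorPair X) where
  le_refl a := by
    refine ⟨le_refl _, le_refl _, ?_⟩
    unfold Permute
    rw [a.comp_eq]
    funext x y
    have h : Relation.Comp (fun x y => a.fst x y) (fun x y => a.snd x y) y x := by
      rw [a.comp_eq]; trivial
    obtain ⟨z, h1, h2⟩ := h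
    exact (eq_true ⟨z, a.snd.symm h2, a.fst.symm h1⟩).symm
  le_trans a b c hab hbc := by
    obtain ⟨h1, h2, h3⟩ := hab
    obtain ⟨k1, k2, k3⟩ := hbc
    have key : ∀ x y z, c.fst x y → a.snd y z → ∃ w, a.snd x w ∧ c.fst w z := by
      intro x y z hxy hyz
      have e1 : Relation.Comp (fun x y => b.snd x y) (fun x y => c.fst x y) x z := by
        rw [← k3]; exact ⟨y, hxy, h2 hyz⟩
      have e2 : Relation.Comp (fun x y => a.snd x y) (fun x y => b.fst x y) x z := by
        rw [← h3]; exact ⟨y, k1 hxy, hyz⟩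
      obtain ⟨v, hv1, hv2⟩ := e1
      obtain ⟨w, hw1, hw2⟩ := e2
      have hwv : w = v := b.eq_of_rel (b.fst.trans hw2 (b.fst.symm (k1 hv2)))
        (b.snd.trans (b.snd.symm (h2 hw1)) hv1)
      subst hwv
      exact ⟨w, hw1, hv2⟩
    refine ⟨k1.trans h1, h2.trans k2, ?_⟩
    funext x z
    apply propext
    constructor
    · rintro ⟨y, hxy, hyz⟩
      exact key x y z hxy hyz
    · rintro ⟨y, hxy, hyz⟩
      obtain ⟨w, hw1, hw2⟩ := key z y x (c.fst.symm hyz) (a.snd.symm hxy)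
      exact ⟨w, c.fst.symm hw2, a.snd.symm hw1⟩
  le_antisymm a b hab hba :=
    FactorPair.ext (le_antisymm hba.1 hab.1) (le_antisymm hab.2.1 hba.2.1)

/-- The constants `0 = (∇, Δ)` and `1 = (Δ, ∇)`. -/
instance : BoundedOrder (FactorPair X) where
  bot :=
    { fst := ⊤
      snd := ⊥
      inf_eq := top_inf_eq _
      comp_eq := by
        funext x y
        exact eq_true ⟨y, trivial, rfl⟩ }
  top :=
    { fst := ⊥
      snd := ⊤
      inf_eq := bot_inf_eq _
      comp_eq := by
        funext x y
        exact eq_true ⟨x, rfl, trivial⟩ }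
  bot_le a := by
    refine ⟨le_top, bot_le, ?_⟩
    funext x y
    apply propext
    constructor
    · rintro ⟨z, h, rfl⟩
      exact ⟨x, rfl, h⟩
    · rintro ⟨z, rfl, h⟩
      exact ⟨y, h, rfl⟩
  le_top a := by
    refine ⟨bot_le, le_top, ?_⟩
    funext x y
    apply propext
    constructor
    · rintro ⟨z, rfl, h⟩
      exact ⟨y, h, rfl⟩
    · rintro ⟨z, h, rfl⟩
      exact ⟨x, rfl, h⟩

end FactorPair

/-- An equivalence relation is an `n`-relation if each of its classes has exactly `n` elements. -/
def IsNRelation {X : Type*} (n : ℕ) (θ : Setoid X) : Prop :=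
  ∀ x : X, {y | θ x y}.encard = n

/-- A `p`-atom of `FactorPair X` is an atom `(θ, θ')` such that `θ'` is a `p`-relation. -/
abbrev PAtom (p : ℕ) (X : Type*) : Type _ :=
  {a : FactorPair X // IsAtom a ∧ IsNRelation p a.snd}

/-- The relation `∼_p`: two `p`-atoms have the same first coordinate and both belong to the
interval `[0, (γ, γ')]` for some factor pair `(γ, γ')` with `|X / γ| = p ^ 3`. -/
def PSim {X : Type*} (p : ℕ) (a b : PAtom p X) : Prop :=
  a.1.fst = b.1.fst ∧
    ∃ g : FactorPair X, ENat.card (Quotient g.fst) = (p ^ 3 : ℕ) ∧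
      a.1 ∈ Set.Icc ⊥ g ∧ b.1 ∈ Set.Icc ⊥ g

/-- The relation `≈_p`: the transitive closure of `∼_p` on the set of `p`-atoms. -/
def PApprox {X : Type*} (p : ℕ) : PAtom p X → PAtom p X → Prop :=
  Relation.TransGen (PSim p)

/-! Factor pairs are product decompositions `X ≃ ι × K`. Two `p`-atoms with the same first
coordinate differ by a family `ρ : ι → Perm K`, and since `ι` is finite it suffices to alter one
fibre at a time. If `K ≃ G × K` with `|G| = p ^ 2` and the permutation acts through `G` alone, both
atoms lie below a pair with quotient `ι × G`, of size `p ^ 3`: one step of `∼_p`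
(`psim_of_isUniformPerm`). Such permutations generate `Perm K` (`closure_isUniformPerm`): every
permutation is a product of two involutions, and every involution is a product of two such
permutations. Only `p ^ 2 ≥ 3` matters, so both primes are treated together. -/

open Cardinal

/-! ### Factor pairs as product decompositions -/

namespace FactorPair

variable {X : Type*}

/-- The factor pair of kernels of the two coordinate maps of a product decomposition. -/
def ofProd {A B : Type*} (e : X ≃ A × B) : FactorPair X where
  fst := Setoid.ker fun x => (e x).1
  snd := Setoid.ker fun x => (e x).2
  inf_eq := by
    ext x y
    constructor
    · rintro ⟨h1, h2⟩
      exact e.injective (Prod.ext h1 h2)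
    · rintro rfl
      exact ⟨rfl, rfl⟩
  comp_eq := by
    funext x y
    refine eq_true ⟨e.symm ((e x).1, (e y).2), ?_, ?_⟩ <;> simp [Setoid.ker_def]

theorem ofProd_fst {A B : Type*} (e : X ≃ A × B) {x y : X} :
    (ofProd e).fst x y ↔ (e x).1 = (e y).1 := Iff.rfl

theorem ofProd_snd {A B : Type*} (e : X ≃ A × B) {x y : X} :
    (ofProd e).snd x y ↔ (e x).2 = (e y).2 := Iff.rfl

theorem ofProd_trans_prodCongr {A B A' B' : Type*} (e : X ≃ A × B) (α : A ≃ A') (β : B ≃ B') :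
    ofProd (e.trans (α.prodCongr β)) = ofProd e := by
  ext x y <;> simp [ofProd_fst, ofProd_snd]

theorem ofProd_le_ofProd_assoc {A B C : Type*} (e : X ≃ A × B × C) :
    ofProd e ≤ ofProd (e.trans (Equiv.prodAssoc A B C).symm) := by
  refine ⟨fun x y h => ?_, fun x y h => ?_, ?_⟩
  · simp only [ofProd_fst, Equiv.trans_apply, Equiv.prodAssoc_symm_apply, Prod.mk.injEq] at h ⊢
    exact h.1
  · simp only [ofProd_snd, Equiv.trans_apply, Equiv.prodAssoc_symm_apply] at h ⊢
    rw [h]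
  -- Both composites amount to equality of the `B`-coordinates.
  · funext x y
    apply propext
    constructor
    · rintro ⟨z, h1, h2⟩
      simp only [ofProd_fst, ofProd_snd, Equiv.trans_apply, Equiv.prodAssoc_symm_apply,
        Prod.mk.injEq] at h1 h2
      refine ⟨e.symm ((e y).1, (e x).2), ?_, ?_⟩ <;>
        simp [ofProd_fst, ofProd_snd, h1.2, h2]
    · rintro ⟨z, h1, h2⟩
      simp only [ofProd_fst, ofProd_snd, Equiv.trans_apply, Equiv.prodAssoc_symm_apply,
        Prod.mk.injEq] at h1 h2
      refine ⟨e.symm ((e x).1, (e y).2), ?_, ?_⟩ <;>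
        simp [ofProd_fst, ofProd_snd, h1, h2.2]

theorem exists_fst_snd (a : FactorPair X) (x y : X) : ∃ z, a.fst z x ∧ a.snd z y := by
  have h : Relation.Comp (fun x y => a.fst x y) (fun x y => a.snd x y) x y := by
    rw [a.comp_eq]; trivial
  obtain ⟨z, h1, h2⟩ := h
  exact ⟨z, a.fst.symm h1, h2⟩

/-- The product decomposition given by a factor pair. -/
noncomputable def toProd (a : FactorPair X) : X ≃ Quotient a.fst × Quotient a.snd :=
  Equiv.ofBijective (fun x => (Quotient.mk _ x, Quotient.mk _ x)) <| by
    constructor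
    · intro x y h
      rw [Prod.mk.injEq] at h
      exact a.eq_of_rel (Quotient.exact h.1) (Quotient.exact h.2)
    · rintro ⟨⟨x⟩, ⟨y⟩⟩
      obtain ⟨z, h1, h2⟩ := a.exists_fst_snd x y
      exact ⟨z, Prod.ext (Quotient.sound h1) (Quotient.sound h2)⟩

theorem ofProd_toProd (a : FactorPair X) : ofProd a.toProd = a := by
  ext x y
  · exact Quotient.eq (r := a.fst)
  · exact Quotient.eq (r := a.snd)

/-- Every class of the second coordinate is a transversal of the first coordinate. -/
noncomputable def classEquiv (a : FactorPair X) (x : X) : {y | a.snd x y} ≃ Quotient a.fst :=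
  Equiv.ofBijective (fun y => Quotient.mk _ y.1) <| by
    constructor
    · rintro ⟨y, hy⟩ ⟨z, hz⟩ h
      exact Subtype.ext (a.eq_of_rel (Quotient.exact h) (a.snd.trans (a.snd.symm hy) hz))
    · rintro ⟨y⟩
      obtain ⟨z, h1, h2⟩ := a.exists_fst_snd y x
      exact ⟨⟨z, a.snd.symm h2⟩, Quotient.sound h1⟩

theorem isNRelation_snd_iff [Nonempty X] (a : FactorPair X) (n : ℕ) :
    IsNRelation n a.snd ↔ ENat.card (Quotient a.fst) = n := by
  have h (x : X) : {y | a.snd x y}.encard = ENat.card (Quotient a.fst) :=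
    ENat.card_congr (a.classEquiv x)
  simp [IsNRelation, h]

/-- A set saturated for the second coordinate is a union of transversals of the first one. -/
theorem card_quotient_fst_dvd_ncard (b : FactorPair X) {S : Set X}
    (hS : ∀ x ∈ S, ∀ y, b.snd x y → y ∈ S) : Nat.card (Quotient b.fst) ∣ S.ncard := by
  have h : b.toProd '' S = Set.univ ×ˢ ((fun x => (b.toProd x).2) '' S) := by
    ext ⟨q, r⟩
    constructor
    · rintro ⟨x, hx, h⟩
      exact ⟨trivial, x, hx, congrArg Prod.snd h⟩
    · rintro ⟨-, x, hx, h⟩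
      refine ⟨b.toProd.symm (q, r), hS x hx _ ?_, by simp⟩
      have hz := congrArg Prod.snd (b.toProd.apply_symm_apply (q, r))
      exact Quotient.exact (h.trans hz.symm)
  rw [← Set.ncard_image_of_injective S b.toProd.injective, h, Set.ncard_prod, Set.ncard_univ]
  exact dvd_mul_right _ _

theorem eq_of_snd_eq {a b : FactorPair X} (h : b.snd = a.snd) (hle : a.fst ≤ b.fst) : b = a := by
  refine FactorPair.ext (le_antisymm (fun x y hxy => ?_) hle) h
  obtain ⟨z, h1, h2⟩ := a.exists_fst_snd x y
  have hzy : z = y := b.eq_of_rel (b.fst.trans (hle h1) hxy) (h ▸ h2)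
  exact a.fst.symm (hzy ▸ h1)

theorem eq_bot_of_subsingleton (b : FactorPair X) (h : Subsingleton (Quotient b.fst)) :
    b = ⊥ := by
  have h1 : b.fst = ⊤ := by
    ext x y
    exact ⟨fun _ => trivial, fun _ => Quotient.exact (h.elim _ _)⟩
  refine FactorPair.ext h1 ?_
  have := b.inf_eq
  rwa [h1, top_inf_eq] at this

/-- For `b` below `a`, a class of `a.snd` has `p` points and is saturated for `b.snd`, so `|X /
b.fst|` divides `p`: the value 1 gives `⊥`, the value `p` gives `a`. -/
theorem isAtom_of_card_quotient_prime [Nonempty X] (a : FactorPair X) {p : ℕ} (hp : p.Prime)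
    (ha : ENat.card (Quotient a.fst) = p) : IsAtom a := by
  have hrel := (a.isNRelation_snd_iff p).2 ha
  have hcl (x : X) : {y | a.snd x y}.ncard = p := by simp [Set.ncard, hrel x]
  refine ⟨?_, fun b hb => ?_⟩
  · rintro rfl
    have : Subsingleton (Quotient (⊥ : FactorPair X).fst) :=
      ⟨by rintro ⟨x⟩ ⟨y⟩; exact Quotient.sound trivial⟩
    have h1 := (ENat.card_le_one_iff_subsingleton _).2 this
    rw [ha] at h1
    exact absurd hp.one_lt (not_lt.2 (by exact_mod_cast h1))
  · obtain ⟨⟨h1, h2, -⟩, hne⟩ := lt_iff_le_and_ne.1 hb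
    obtain ⟨x₀⟩ := ‹Nonempty X›
    have hdvd := b.card_quotient_fst_dvd_ncard (S := {y | a.snd x₀ y})
      fun x hx y hxy => a.snd.trans hx (h2 hxy)
    rw [hcl] at hdvd
    rcases (Nat.dvd_prime hp).1 hdvd with h | h
    · exact b.eq_bot_of_subsingleton (Nat.card_eq_one_iff_unique.1 h).1
    · refine absurd (eq_of_snd_eq (le_antisymm h2 fun x y hxy => ?_) h1) hne
      have hb : {y | b.snd x y}.ncard = p := h ▸ Nat.card_congr (b.classEquiv x)
      have heq := Set.eq_of_subset_of_ncard_le (s := {y | b.snd x y}) (t := {y | a.snd x y})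
        (fun y hy => h2 hy) (by rw [hb, hcl])
        (Set.finite_of_ncard_pos (by rw [hcl]; exact hp.pos))
      exact heq.symm.subset hxy

end FactorPair

/-! ### Generating `Perm K` by uniform permutations -/

section Permutations

variable {K : Type*}

/-- A permutation that, for some splitting of `K` into blocks of `n` points, acts on all blocks in
the same way. -/
def IsUniformPerm (n : ℕ) (τ : Equiv.Perm K) : Prop :=
  ∃ (G : Type) (ψ : G × K ≃ K) (τ₀ : Equiv.Perm G), Nat.card G = n ∧
    ∀ g k, τ (ψ (g, k)) = ψ (τ₀ g, k)

/-- Every permutation is a product of two involutions. -/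
theorem Equiv.Perm.exists_mul_eq_of_involutive (σ : Equiv.Perm K) :
    ∃ α β : Equiv.Perm K, Function.Involutive α ∧ Function.Involutive β ∧ α * β = σ := by
  let r : K → K := fun x => (Quotient.mk (Equiv.Perm.SameCycle.setoid σ) x).out
  have hr (x : K) : ∃ i : ℤ, (σ ^ i) (r x) = x :=
    Quotient.exact (s := Equiv.Perm.SameCycle.setoid σ) (Quotient.out_eq _)
  choose i hi using hr
  have hrr (x : K) (j : ℤ) : r ((σ ^ j) (r x)) = r x := by
    have : Quotient.mk (Equiv.Perm.SameCycle.setoid σ) ((σ ^ j) (r x)) =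
        Quotient.mk (Equiv.Perm.SameCycle.setoid σ) x :=
      (Quotient.sound (s := Equiv.Perm.SameCycle.setoid σ) ⟨-j, by simp [r]⟩).trans
        (Quotient.out_eq (Quotient.mk (Equiv.Perm.SameCycle.setoid σ) x))
    exact congrArg Quotient.out this
  -- Reflect each cycle about its base point `r x`; `hf` shows that the choice of exponent,
  -- ambiguous on finite cycles, is irrelevant.
  let f : K → K := fun x => (σ ^ (-i x)) (r x)
  have hf (x : K) (j : ℤ) : f ((σ ^ j) (r x)) = (σ ^ (-j)) (r x) := by
    have h := hi ((σ ^ j) (r x))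
    rw [hrr] at h
    simp only [f, hrr]
    rw [zpow_neg, zpow_neg, Equiv.Perm.inv_eq_iff_eq, ← Equiv.Perm.mul_apply,
      (Commute.refl σ).zpow_zpow _ _ |>.inv_right.eq, Equiv.Perm.mul_apply, h]
    simp
  have hff : Function.Involutive f := fun x => by
    have h := hf x (i x)
    rw [hi] at h
    rw [h, hf, neg_neg, hi]
  have hfs (x : K) : f (σ (f (σ x))) = x := by
    have h1 : σ x = (σ ^ (1 + i x)) (r x) := by
      rw [zpow_one_add, Equiv.Perm.mul_apply, hi]
    rw [h1, hf, ← Equiv.Perm.mul_apply, ← zpow_one_add, hf]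
    rw [show -(1 + -(1 + i x)) = i x by ring, hi]
  refine ⟨hff.toPerm, hff.toPerm * σ, hff, hfs, ?_⟩
  ext x
  simpa using hff (σ x)

theorem mk_set_eq_of_injective {S : Set K} (f : K → K) (hf : f.Injective) (hS : ∀ k, f k ∈ S) :
    #S = #K :=
  le_antisymm (mk_set_le S) (mk_le_of_injective (f := fun k => (⟨f k, hS k⟩ : S))
    fun _ _ h => hf (congrArg Subtype.val h))

theorem nonempty_prod_equiv_of_mk_eq [Infinite K] {S : Set K} (hS : #S = #K) (G : Type) [Finite G]
    [Nonempty G] : Nonempty (G × K ≃ S) := by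
  rw [← lift_mk_eq'.{_, _}]
  have := Fintype.ofFinite G
  simp only [lift_id, mk_prod, hS, lift_uzero]
  refine mul_eq_right (aleph0_le_mk K) ?_ ?_
  · exact (lift_lt_aleph0.2 (lt_aleph0_of_finite G)).le.trans (aleph0_le_mk K)
  · simp

/-- A transversal for the 2-cycles of an involution. -/
theorem exists_transversal {τ : Equiv.Perm K} (hτ : Function.Involutive τ) :
    ∃ T : Set K, (∀ x ∈ T, τ x ∉ T) ∧ (∀ x, τ x ≠ x → x ∈ T ∨ τ x ∈ T) ∧
      ∀ x ∈ T, τ x ≠ x := by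
  obtain ⟨_, -⟩ := exists_wellFoundedLT K
  refine ⟨{x | x < τ x}, fun x hx h => ?_, fun x hx => ?_, fun x hx => ne_of_gt hx⟩
  · simp only [Set.mem_ofPred_eq, hτ x] at hx h
    exact lt_asymm hx h
  · simp only [Set.mem_ofPred_eq, hτ x]
    exact (lt_or_gt_of_ne hx).symm

variable [Infinite K]

theorem mk_transversal {τ : Equiv.Perm K} {T : Set K}
    (hT : ∀ x, τ x ≠ x → x ∈ T ∨ τ x ∈ T) (hmov : #{x | τ x ≠ x} = #K) : #T = #K := by
  have h1 : {x | τ x ≠ x} ⊆ T ∪ τ ⁻¹' T := hT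
  have h2 : #K ≤ #T + #T := by
    rw [← hmov]
    refine (mk_le_mk_of_subset h1).trans ((mk_union_le _ _).trans ?_)
    rw [mk_preimage_equiv]
  refine le_antisymm (mk_set_le T) (le_of_not_gt fun h => ?_)
  exact absurd h2 (not_le.2 (add_lt_of_lt (aleph0_le_mk K) h h))

/-- Each block consists of one 2-cycle and `n - 2 ≥ 1` fixed points; the two cardinality hypotheses
supply `|K|` blocks. -/
theorem isUniformPerm_of_involutive {τ : Equiv.Perm K} (hτ : Function.Involutive τ)
    (hfix : #{x | τ x = x} = #K) (hmov : #{x | τ x ≠ x} = #K) {n : ℕ} (hn : 3 ≤ n) :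
    IsUniformPerm n τ := by
  obtain ⟨T, hT1, hT2, hT3⟩ := exists_transversal hτ
  have hT := mk_transversal hT2 hmov
  obtain ⟨m, rfl⟩ := Nat.exists_eq_add_of_le hn
  obtain ⟨eC⟩ := nonempty_prod_equiv_of_mk_eq hfix (Fin (m + 1))
  obtain ⟨eT⟩ := Cardinal.eq.1 hT.symm
  let f : (Bool × K) ⊕ (Fin (m + 1) × K) → K :=
    Sum.elim (fun q => cond q.1 (τ (eT q.2)) (eT q.2)) (fun q => eC q)
  have hf : f.Bijective := by
    constructor
    · have hτi := τ.injective
      rintro (⟨_ | _, k⟩ | q) (⟨_ | _, k'⟩ | q') h <;> simp only [f, Sum.elim_inl, Sum.elim_inr,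
        cond_true, cond_false] at h
      · rw [eT.injective (Subtype.ext h)]
      · exact absurd (h ▸ (eT k).2) (hT1 _ (eT k').2)
      · exact absurd (h ▸ (eC q').2) (hT3 _ (eT k).2)
      · exact absurd (h ▸ (eT k').2) (hT1 _ (eT k).2)
      · rw [eT.injective (Subtype.ext (hτi h))]
      · have h2 : τ (eC q') = eC q' := (eC q').2
        rw [← h] at h2
        exact absurd (hτi h2) (hT3 _ (eT k).2)
      · exact absurd (h ▸ (eC q).2) (hT3 _ (eT k').2)
      · have h2 : τ (eC q) = eC q := (eC q).2
        rw [h] at h2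
        exact absurd (hτi h2) (hT3 _ (eT k').2)
      · rw [eC.injective (Subtype.ext h)]
    · intro x
      by_cases hx : τ x = x
      · exact ⟨Sum.inr (eC.symm ⟨x, hx⟩), by simp [f]⟩
      · rcases hT2 x hx with h | h
        · exact ⟨Sum.inl (false, eT.symm ⟨x, h⟩), by simp [f]⟩
        · exact ⟨Sum.inl (true, eT.symm ⟨_, h⟩), by simp [f, hτ x]⟩
  refine ⟨Bool ⊕ Fin (m + 1), (Equiv.sumProdDistrib _ _ _).trans (Equiv.ofBijective f hf),
    Equiv.sumCongr Equiv.boolNot (Equiv.refl _), by simp; omega, ?_⟩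
  rintro ((_ | _) | g) k
  · simp [f]
  · simp [f, hτ _]
  · have h : τ (eC (g, k)) = eC (g, k) := (eC (g, k)).2
    simpa [f] using h

/-- An involution with as many moved points as there are points is a product of two uniform
permutations. -/
theorem mem_closure_of_mk_moved {τ : Equiv.Perm K} (hτ : Function.Involutive τ)
    (hmov : #{x | τ x ≠ x} = #K) {n : ℕ} (hn : 3 ≤ n) :
    τ ∈ Submonoid.closure {τ : Equiv.Perm K | IsUniformPerm n τ} := by
  classical
  obtain ⟨T, hT1, hT2, hT3⟩ := exists_transversal hτ
  obtain ⟨e⟩ := nonempty_prod_equiv_of_mk_eq (mk_transversal hT2 hmov) Bool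
  -- `P` selects half of the 2-cycles, leaving `|K|` of them on either side; `τ` is split
  -- accordingly.
  let P : K → Prop := fun x => ∃ k, (e (true, k) : K) = x ∨ τ (e (true, k)) = x
  have hP (x : K) : P (τ x) ↔ P x := by
    refine exists_congr fun k => ?_
    rw [τ.injective.eq_iff, or_comm]
    exact or_congr Iff.rfl hτ.eq_iff.symm
  have hPt (k : K) : P (e (true, k)) := ⟨k, Or.inl rfl⟩
  have hPf (k : K) : ¬ P (e (false, k)) := by
    rintro ⟨k', h | h⟩
    · simpa using e.injective (Subtype.ext h)
    · exact hT1 _ (e (true, k')).2 (h ▸ (e (false, k)).2)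
  have h1 : Function.Involutive (fun x => if P x then τ x else x) := fun x => by
    by_cases h : P x <;> simp [h, hP, hτ x]
  have h2 : Function.Involutive (fun x => if P x then x else τ x) := fun x => by
    by_cases h : P x <;> simp [h, hP, hτ x]
  have hinj (b : Bool) : Function.Injective (fun k => (e (b, k) : K)) := fun k k' h => by
    simpa using e.injective (Subtype.ext h)
  have hmul : h1.toPerm * h2.toPerm = τ := by
    ext x
    by_cases h : P x <;> simp [h, hP]
  rw [← hmul]
  refine mul_mem (Submonoid.subset_closure ?_) (Submonoid.subset_closure ?_)
  · exact isUniformPerm_of_involutive h1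
      (mk_set_eq_of_injective _ (hinj false) fun k => by simp [hPf])
      (mk_set_eq_of_injective _ (hinj true) fun k => by simpa [hPt] using hT3 _ (e _).2) hn
  · exact isUniformPerm_of_involutive h2
      (mk_set_eq_of_injective _ (hinj true) fun k => by simp [hPt])
      (mk_set_eq_of_injective _ (hinj false) fun k => by simpa [hPf] using hT3 _ (e _).2) hn

/-- An involution with as many fixed points as there are points is a product of two uniform
permutations. -/
theorem mem_closure_of_mk_fixed {τ : Equiv.Perm K} (hτ : Function.Involutive τ)
    (hfix : #{x | τ x = x} = #K) {n : ℕ} (hn : 3 ≤ n) :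
    τ ∈ Submonoid.closure {τ : Equiv.Perm K | IsUniformPerm n τ} := by
  classical
  obtain ⟨e⟩ := nonempty_prod_equiv_of_mk_eq hfix (Option Bool)
  let c : Equiv.Perm (Option Bool) := Equiv.optionCongr Equiv.boolNot
  -- Cut the fixed points of `τ` into three parts of size `|K|`; `υ` swaps two and fixes the third,
  -- so `υ` and `τ * υ` both move and fix `|K|` points.
  let υ : Equiv.Perm K := Equiv.Perm.ofSubtype (p := fun x => x ∈ {x | τ x = x})
    (e.permCongr (c.prodCongr (Equiv.refl K)))
  have hυ (o : Option Bool) (k : K) : υ (e (o, k)) = e (c o, k) := by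
    simp [υ, Equiv.Perm.ofSubtype_apply_coe]
  have hυ' (x : K) (hx : τ x ≠ x) : υ x = x := Equiv.Perm.ofSubtype_apply_of_not_mem _ hx
  have hτe (q : Option Bool × K) : τ (e q) = e q := (e q).2
  have hcc (o : Option Bool) : c (c o) = o := by rcases o with _ | _ | _ <;> rfl
  have hcases (x : K) : τ x ≠ x ∨ ∃ o k, (e (o, k) : K) = x := by
    by_cases hx : τ x = x
    · exact Or.inr ⟨(e.symm ⟨x, hx⟩).1, (e.symm ⟨x, hx⟩).2, by simp⟩
    · exact Or.inl hx
  have hυi : Function.Involutive υ := fun x => by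
    rcases hcases x with hx | ⟨o, k, rfl⟩
    · rw [hυ' x hx, hυ' x hx]
    · rw [hυ, hυ, hcc]
  have hτυ : Function.Involutive (τ * υ) := fun x => by
    rcases hcases x with hx | ⟨o, k, rfl⟩
    · have hx' : τ (τ x) ≠ τ x := fun h => hx (τ.injective h)
      simp only [Equiv.Perm.mul_apply]
      rw [hυ' x hx, hυ' _ hx', hτ]
    · simp only [Equiv.Perm.mul_apply, hυ, hτe, hcc]
  have hinj (o : Option Bool) : Function.Injective (fun k => (e (o, k) : K)) := fun k k' h => by
    simpa using e.injective (Subtype.ext h)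
  have hne (k : K) : (e (c (some true), k) : K) ≠ e (some true, k) := fun h => by
    simpa [c] using e.injective (Subtype.ext h)
  have hmul : τ * υ * υ = τ := by
    ext x
    simp [hυi x]
  rw [← hmul]
  refine mul_mem (Submonoid.subset_closure ?_) (Submonoid.subset_closure ?_)
  · exact isUniformPerm_of_involutive hτυ
      (mk_set_eq_of_injective _ (hinj none) fun k => by simp [hυ, hτe, c])
      (mk_set_eq_of_injective _ (hinj (some true)) fun k => by
        simpa only [Set.mem_ofPred_eq, Equiv.Perm.mul_apply, hυ, hτe] using hne k) hn
  · exact isUniformPerm_of_involutive hυi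
      (mk_set_eq_of_injective _ (hinj none) fun k => by simp [hυ, c])
      (mk_set_eq_of_injective _ (hinj (some true)) fun k => by
        simpa only [Set.mem_ofPred_eq, hυ] using hne k) hn

theorem closure_isUniformPerm {n : ℕ} (hn : 3 ≤ n) :
    Submonoid.closure {τ : Equiv.Perm K | IsUniformPerm n τ} = ⊤ := by
  have key (τ : Equiv.Perm K) (hτ : Function.Involutive τ) :
      τ ∈ Submonoid.closure {τ : Equiv.Perm K | IsUniformPerm n τ} := by
    by_cases hfix : #{x | τ x = x} = #K
    · exact mem_closure_of_mk_fixed hτ hfix hn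
    · refine mem_closure_of_mk_moved hτ ?_ hn
      exact mk_compl_of_infinite _ (lt_of_le_of_ne (mk_set_le _) hfix)
  refine eq_top_iff.2 fun σ _ => ?_
  obtain ⟨α, β, hα, hβ, rfl⟩ := σ.exists_mul_eq_of_involutive
  exact mul_mem (key α hα) (key β hβ)

end Permutations

/-! ### Chains of `p`-atoms -/

section Chains

variable {X ι K : Type*} {p : ℕ}

theorem card_quotient_ofProd_fst [Nonempty X] (e : X ≃ ι × K) :
    ENat.card (Quotient (FactorPair.ofProd e).fst) = ENat.card ι := by
  obtain ⟨x⟩ := ‹Nonempty X›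
  refine ENat.card_congr (Setoid.quotientKerEquivOfSurjective _ fun i => ?_)
  exact ⟨e.symm (i, (e x).2), by simp⟩

/-- The `p`-atom given by a product decomposition whose first factor has `p` elements. -/
def PAtom.ofProd [Nonempty X] (hp : p.Prime) (hι : ENat.card ι = p) (e : X ≃ ι × K) :
    PAtom p X :=
  ⟨FactorPair.ofProd e,
    FactorPair.isAtom_of_card_quotient_prime _ hp ((card_quotient_ofProd_fst e).trans hι),
    (FactorPair.isNRelation_snd_iff _ p).2 ((card_quotient_ofProd_fst e).trans hι)⟩

theorem psim_of_isUniformPerm [Nonempty X] [DecidableEq ι] (hp : p.Prime) (hι : ENat.card ι = p)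
    (e : X ≃ ι × K) (i : ι) {τ : Equiv.Perm K} (hτ : IsUniformPerm (p ^ 2) τ) :
    PSim p (PAtom.ofProd hp hι e)
      (PAtom.ofProd hp hι (e.trans (Equiv.prodCongrRight (Pi.mulSingle i τ)))) := by
  obtain ⟨G, ψ, τ₀, hG, hψ⟩ := hτ
  have hGfin : Finite G := Nat.finite_of_card_ne_zero (hG ▸ pow_ne_zero 2 hp.ne_zero)
  refine ⟨?_, ?_⟩
  · ext x y
    exact Iff.rfl
  let e₁ : X ≃ ι × G × K := e.trans ((Equiv.refl ι).prodCongr ψ.symm)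
  let e₂ : X ≃ ι × G × K := (e.trans (Equiv.prodCongrRight (Pi.mulSingle i τ))).trans
    ((Equiv.refl ι).prodCongr ψ.symm)
  -- The change of decomposition only permutes `ι × G`, so the two regrouped decompositions define
  -- the same upper factor pair.
  let α : ι × G ≃ ι × G := Equiv.prodCongrRight (Pi.mulSingle i τ₀)
  have hα : e₂.trans (Equiv.prodAssoc ι G K).symm =
      (e₁.trans (Equiv.prodAssoc ι G K).symm).trans (α.prodCongr (Equiv.refl K)) := by
    ext x : 1
    obtain ⟨j, q, h⟩ : ∃ j q, e x = (j, ψ q) := ⟨(e x).1, ψ.symm (e x).2, by simp⟩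
    obtain ⟨g, k⟩ := q
    by_cases hj : j = i
    · subst hj
      simp [e₁, e₂, α, h, hψ]
    · simp [e₁, e₂, α, h, Pi.mulSingle_eq_of_ne hj]
  refine ⟨FactorPair.ofProd (e₁.trans (Equiv.prodAssoc ι G K).symm), ?_,
    ⟨bot_le, ?_⟩, ⟨bot_le, ?_⟩⟩
  · rw [card_quotient_ofProd_fst, ENat.card_prod, hι, ENat.card_eq_coe_natCard G, hG]
    push_cast
    ring
  · rw [show (PAtom.ofProd hp hι e).1 = FactorPair.ofProd e₁ from
      (FactorPair.ofProd_trans_prodCongr e _ _).symm]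
    exact FactorPair.ofProd_le_ofProd_assoc e₁
  · rw [← FactorPair.ofProd_trans_prodCongr _ α (Equiv.refl K), ← hα,
      show (PAtom.ofProd hp hι (e.trans (Equiv.prodCongrRight (Pi.mulSingle i τ)))).1 =
        FactorPair.ofProd e₂ from (FactorPair.ofProd_trans_prodCongr _ _ _).symm]
    exact FactorPair.ofProd_le_ofProd_assoc e₂

theorem papprox_ofProd [Infinite K] [Nonempty X] (hp : p.Prime) (hι : ENat.card ι = p)
    (e : X ≃ ι × K) (ρ : ι → Equiv.Perm K) :
    PApprox p (PAtom.ofProd hp hι e) (PAtom.ofProd hp hι (e.trans (Equiv.prodCongrRight ρ))) := by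
  classical
  have hfin : Finite ι := ENat.card_lt_top.1 (hι ▸ ENat.natCast_lt_top p)
  have hn : 3 ≤ p ^ 2 := by nlinarith [hp.two_le]
  obtain ⟨i₀⟩ : Nonempty ι := ⟨(e (Classical.arbitrary X)).1⟩
  -- Quantifying over all `e` makes `H` closed under products: the second chain starts from the
  -- decomposition where the first ends.
  let H : Submonoid (ι → Equiv.Perm K) :=
    { carrier := {ρ | ∀ e : X ≃ ι × K, Relation.ReflTransGen (PSim p) (PAtom.ofProd hp hι e)
        (PAtom.ofProd hp hι (e.trans (Equiv.prodCongrRight ρ)))}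
      one_mem' := fun e => by
        have : e.trans (Equiv.prodCongrRight (1 : ι → Equiv.Perm K)) = e := by ext x <;> simp
        rw [this]
      mul_mem' := fun {ρ ρ'} h h' e => by
        have : e.trans (Equiv.prodCongrRight (ρ * ρ')) =
            (e.trans (Equiv.prodCongrRight ρ')).trans (Equiv.prodCongrRight ρ) := by
          ext x <;> simp
        rw [this]
        exact (h' e).trans (h _) }
  have hH (i : ι) (τ : Equiv.Perm K) : Pi.mulSingle i τ ∈ H := by
    have hle : Submonoid.closure {τ : Equiv.Perm K | IsUniformPerm (p ^ 2) τ} ≤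
        H.comap (MonoidHom.mulSingle (fun _ => Equiv.Perm K) i) :=
      Submonoid.closure_le.2 fun τ hτ e =>
        Relation.ReflTransGen.single (psim_of_isUniformPerm hp hι e i hτ)
    rw [closure_isUniformPerm hn] at hle
    exact hle (Submonoid.mem_top τ)
  have hρ : ρ ∈ H := Submonoid.pi_mem_of_mulSingle_mem ρ fun i => hH i (ρ i)
  -- `TransGen` needs at least one step, whereas `H` only yields a reflexive chain.
  have hself : PSim p (PAtom.ofProd hp hι e) (PAtom.ofProd hp hι e) := by
    have : NeZero (p ^ 2) := ⟨pow_ne_zero 2 hp.ne_zero⟩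
    obtain ⟨ψ⟩ := nonempty_prod_equiv_of_mk_eq (mk_univ (α := K)) (Fin (p ^ 2))
    obtain ⟨-, g, hg, ha, -⟩ := psim_of_isUniformPerm hp hι e i₀ (τ := 1)
      ⟨Fin (p ^ 2), ψ.trans (Equiv.Set.univ K), 1, by simp, fun _ _ => rfl⟩
    exact ⟨rfl, g, hg, ha, ha⟩
  exact (Relation.TransGen.single hself).trans_left (hρ e)

theorem papprox_of_fst_eq [Infinite X] (hp : p.Prime) (a b : PAtom p X)
    (h : a.1.fst = b.1.fst) : PApprox p a b := by
  obtain ⟨⟨θ, θ₁, h1, h2⟩, ha⟩ := a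
  obtain ⟨⟨θ', θ₂, k1, k2⟩, hb⟩ := b
  obtain rfl : θ = θ' := h
  set a : FactorPair X := ⟨θ, θ₁, h1, h2⟩
  set b : FactorPair X := ⟨θ, θ₂, k1, k2⟩
  have hι : ENat.card (Quotient θ) = p := (a.isNRelation_snd_iff p).1 ha.2
  have hfin : Finite (Quotient θ) := ENat.card_lt_top.1 (hι ▸ ENat.natCast_lt_top p)
  have hK : Infinite (Quotient θ₁) := by
    by_contra hK
    rw [not_infinite_iff_finite] at hK
    exact not_finite_iff_infinite.2 ‹Infinite X› (Finite.of_equiv _ a.toProd.symm)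
  let i₀ : Quotient θ := Quotient.mk _ (Classical.arbitrary X)
  have hfst (i : Quotient θ) (k : Quotient θ₁) : (b.toProd (a.toProd.symm (i, k))).1 = i :=
    congrArg Prod.fst (a.toProd.apply_symm_apply (i, k))
  have hfst' (i : Quotient θ) (k : Quotient θ₂) : (a.toProd (b.toProd.symm (i, k))).1 = i :=
    congrArg Prod.fst (b.toProd.apply_symm_apply (i, k))
  let δ : Quotient θ → (Quotient θ₁ ≃ Quotient θ₂) := fun i =>
    { toFun := fun k => (b.toProd (a.toProd.symm (i, k))).2
      invFun := fun k => (a.toProd (b.toProd.symm (i, k))).2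
      left_inv := fun k => by
        have hx : (i, (b.toProd (a.toProd.symm (i, k))).2) = b.toProd (a.toProd.symm (i, k)) :=
          Prod.ext (hfst i k).symm rfl
        simp only [hx, Equiv.symm_apply_apply, Equiv.apply_symm_apply]
      right_inv := fun k => by
        have hx : (i, (a.toProd (b.toProd.symm (i, k))).2) = a.toProd (b.toProd.symm (i, k)) :=
          Prod.ext (hfst' i k).symm rfl
        simp only [hx, Equiv.symm_apply_apply, Equiv.apply_symm_apply] }
  -- Composing with `(δ i₀).symm` identifies the two second factors; this relabelling leaves `b`
  -- unchanged.
  let ρ : Quotient θ → Equiv.Perm (Quotient θ₁) := fun i => (δ i).trans (δ i₀).symm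
  have hb' : a.toProd.trans (Equiv.prodCongrRight ρ) =
      b.toProd.trans ((Equiv.refl (Quotient θ)).prodCongr (δ i₀).symm) := by
    ext x : 1
    have hx : a.toProd.symm ((a.toProd x).1, (a.toProd x).2) = x := a.toProd.symm_apply_apply x
    refine Prod.ext rfl (congrArg (δ i₀).symm ?_)
    exact congrArg (fun y => (b.toProd y).2) hx
  have key := papprox_ofProd hp hι a.toProd ρ
  convert key using 1
  · exact Subtype.ext a.ofProd_toProd.symm
  · refine Subtype.ext ?_
    change b = FactorPair.ofProd (a.toProd.trans (Equiv.prodCongrRight ρ))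
    rw [hb', FactorPair.ofProd_trans_prodCongr, b.ofProd_toProd]

end Chains

theorem mainTheorem8 {X : Type*} [Infinite X] :
    (∀ a b : PAtom 3 X, a.1.fst = b.1.fst → PApprox 3 a b) ∧
    (∀ a b : PAtom 2 X, a.1.fst = b.1.fst → PApprox 2 a b) :=
  ⟨fun a b h => papprox_of_fst_eq Nat.prime_three a b h,
    fun a b h => papprox_of_fst_eq Nat.prime_two a b h⟩
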